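/- Let $1<p<\infty$, $0\le\beta<1-\frac1p$ and $Q=[-\pi,\pi]$. Let $L^p$ be the class of $2\pi$-periodic real functions $f$ with $\|f\|_{L^p}=\left(\int_Q|f(t)|^p\,dt\right)^{1/p}<\infty$. Let $\omega$ be a function of modulus of continuity type on $[0,2\pi]$: $\omega$ is nondecreasing and continuous, $\omega(0)=0$, and $\omega(\delta_1+\delta_2)\le\omega(\delta_1)+\omega(\delta_2)$ whenever $0\le\delta_1\le\delta_2\le\delta_1+\delta_2\le2\pi$. For $f\in L^p$ put $\varphi_x(t)=f(x+t)+f(x-t)-2f(x)$ and $$\omega_\beta f(\delta)_{L^p}=\sup_{0\le|t|\le\delta}\left\{\left|\sin\tfrac t2\right|^{\beta p}\int_{-\pi}^{\pi}|\varphi_x(t)|^p\,dx\right\}^{1/p},$$ and let $L^p(\omega)_\beta$ be the set of all $f\in L^p$ for which there is a constant $M$ with $\omega_\beta f(\delta)_{L^p}\le M\,\omega(\delta)$ for all $\delta\in[0,2\pi]$. Let $A=(a_{n,k})$ be an infinite lower triangular matrix of real numbers with $a_{n,k}\ge0$ for $0\le k\le n$, $a_{n,k}=0$ for $k>n$, and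 $\sum_{k=0}^na_{n,k}=1$ for $n=0,1,2,\dots$. Put $T_{n,A}f=\sum_{k=0}^na_{n,k}S_kf$, where $S_kf$ is the $k$-th partial sum of the trigonometric Fourier series of $f$. Let $f\in L^p(\omega)_\beta$. (i) Suppose that the rows of $A$ are of class MRBVS with a common constant: there is $K$ such that, for all integers $1\le m<n$, $$\sum_{k=m}^{n-1}|a_{n,k}-a_{n,k+1}|\le\frac K{m+1}\sum_{m/2\le k\le m}a_{n,k}.$$ Then there is a constant $C$, independent of $n$, such that for all $n=0,1,2,\dots$ $$\|T_{n,A}f-f\|_{L^p}\le C\,(n+1)^{\beta}\sum_{k=0}^na_{n,k}\,\omega\!\left(\frac\pi{k+1}\right)\ \text{ if }\beta>0,\qquad \|T_{n,A}f-f\|_{L^p}\le C\,(n+1)^{1/p}\sum_{k=0}^na_{n,k}\,\omega\!\left(\frac\pi{k+1}\right)\ \text{ if }\beta=0.$$ (ii) Suppose that the rows of $A$ are of class MHBVS with a common constant: there is $K$ such that, for all integers $1\le m<n$, $$\sum_{k=0}^{n-m-1}|a_{n,k}-a_{n,k+1}|\le\frac K{m+1}\sum_{k=n-m}^{n}a_{n,k}.$$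 Then there is a constant $C$, independent of $n$, such that for all $n=0,1,2,\dots$ $$\|T_{n,A}f-f\|_{L^p}\le C\,(n+1)^{\beta}\sum_{k=0}^na_{n,n-k}\,\omega\!\left(\frac\pi{k+1}\right)\ \text{ if }\beta>0,\qquad \|T_{n,A}f-f\|_{L^p}\le C\,(n+1)^{1/p}\sum_{k=0}^na_{n,n-k}\,\omega\!\left(\frac\pi{k+1}\right)\ \text{ if }\beta=0.$$ -/

import Mathlib

open MeasureTheory
open scoped ENNReal

noncomputable section

namespace FourierMatrixMeans

/-- Lebesgue measure on one period `Q = [-π, π]`. -/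
def periodMeasure : Measure ℝ := volume.restrict (Set.Icc (-Real.pi) Real.pi)

/-- The norm `(∫_Q |g|^p)^(1/p)`, with values in `[0, ∞]`. -/
def normLp (p : ℝ) (g : ℝ → ℝ) : ℝ≥0∞ := eLpNorm g (ENNReal.ofReal p) periodMeasure

/-- The class `L^p` of `2π`-periodic real functions whose `p`-th power is integrable on `Q`. -/
def periodicLp (p : ℝ) : Set (ℝ → ℝ) :=
  {f | Function.Periodic f (2 * Real.pi) ∧ MemLp f (ENNReal.ofReal p) periodMeasure}

/-- The Fourier cosine coefficient `a_ν(f)`. -/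
def cosCoeff (f : ℝ → ℝ) (ν : ℕ) : ℝ :=
  (1 / Real.pi) * ∫ t in (-Real.pi)..Real.pi, f t * Real.cos (ν * t)

/-- The Fourier sine coefficient `b_ν(f)`. -/
def sinCoeff (f : ℝ → ℝ) (ν : ℕ) : ℝ :=
  (1 / Real.pi) * ∫ t in (-Real.pi)..Real.pi, f t * Real.sin (ν * t)

/-- The partial sum `S_k f` of the trigonometric Fourier series of `f`. -/
def partialSum (f : ℝ → ℝ) (k : ℕ) (x : ℝ) : ℝ :=
  cosCoeff f 0 / 2 +
    ∑ ν ∈ Finset.Icc 1 k,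
      (cosCoeff f ν * Real.cos (ν * x) + sinCoeff f ν * Real.sin (ν * x))

/-- A lower triangular matrix with nonnegative entries and row sums equal to one. -/
structure IsMeanMatrix (a : ℕ → ℕ → ℝ) : Prop where
  nonneg : ∀ n k, k ≤ n → 0 ≤ a n k
  eq_zero : ∀ n k, n < k → a n k = 0
  sum_eq_one : ∀ n, ∑ k ∈ Finset.range (n + 1), a n k = 1

/-- The matrix mean `T_{n,A} f = ∑_{k=0}^n a_{n,k} S_k f`. -/
def matrixMean (a : ℕ → ℕ → ℝ) (n : ℕ) (f : ℝ → ℝ) (x : ℝ) : ℝ :=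
  ∑ k ∈ Finset.range (n + 1), a n k * partialSum f k x

/-- The rows `(a_{n,k})_{k=0}^n` are of mean rest bounded variation, with one constant for all
rows: `∑_{k=m}^{n-1} |a_{n,k} - a_{n,k+1}| ≤ K / (m+1) * ∑_{m/2 ≤ k ≤ m} a_{n,k}`. -/
def RowsMRBVS (a : ℕ → ℕ → ℝ) : Prop :=
  ∃ K : ℝ, ∀ n m : ℕ, 1 ≤ m → m < n →
    ∑ k ∈ Finset.Ico m n, |a n k - a n (k + 1)| ≤
      K * (1 / ((m : ℝ) + 1)) * ∑ k ∈ (Finset.range (m + 1)).filter (fun k => m ≤ 2 * k), a n k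

/-- The rows `(a_{n,k})_{k=0}^n` are of mean head bounded variation, with one constant for all
rows: `∑_{k=0}^{n-m-1} |a_{n,k} - a_{n,k+1}| ≤ K / (m+1) * ∑_{k=n-m}^{n} a_{n,k}`. -/
def RowsMHBVS (a : ℕ → ℕ → ℝ) : Prop :=
  ∃ K : ℝ, ∀ n m : ℕ, 1 ≤ m → m < n →
    ∑ k ∈ Finset.range (n - m), |a n k - a n (k + 1)| ≤
      K * (1 / ((m : ℝ) + 1)) * ∑ k ∈ Finset.Icc (n - m) n, a n k

/-- The symmetric second difference `φ_x(t) = f(x+t) + f(x-t) - 2 f(x)`. -/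
def phi (f : ℝ → ℝ) (x t : ℝ) : ℝ := f (x + t) + f (x - t) - 2 * f x

/-- The generalized modulus of continuity
`ω_β f(δ) = sup_{|t| ≤ δ} |sin (t/2)|^β * (∫_Q |φ_x(t)|^p dx)^(1/p)`, with values in `[0, ∞]`. -/
def genModulus (p β : ℝ) (f : ℝ → ℝ) (δ : ℝ) : ℝ≥0∞ :=
  ⨆ (t : ℝ) (_ : |t| ≤ δ),
    ENNReal.ofReal (|Real.sin (t / 2)| ^ β) * normLp p (fun x => phi f x t)

/-- A function of modulus of continuity type on `[0, 2π]`. -/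
structure IsModulusType (ω : ℝ → ℝ) : Prop where
  monotoneOn : MonotoneOn ω (Set.Icc 0 (2 * Real.pi))
  continuousOn : ContinuousOn ω (Set.Icc 0 (2 * Real.pi))
  map_zero : ω 0 = 0
  subadditive : ∀ δ₁ δ₂ : ℝ, 0 ≤ δ₁ → δ₁ ≤ δ₂ → δ₁ + δ₂ ≤ 2 * Real.pi →
    ω (δ₁ + δ₂) ≤ ω δ₁ + ω δ₂

/-- The class `L^p(ω)_β` of all `f ∈ L^p` with `ω_β f(δ) ≪ ω(δ)` on `[0, 2π]`. -/
def classLpOmega (p β : ℝ) (ω : ℝ → ℝ) : Set (ℝ → ℝ) :=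
  {f | f ∈ periodicLp p ∧ ∃ M : ℝ, ∀ δ ∈ Set.Icc 0 (2 * Real.pi),
    genModulus p β f δ ≤ ENNReal.ofReal (M * ω δ)}

end FourierMatrixMeans

end

/-! The deviation `T_{n,A} f - f` is `1/π` times the integral over `(0, π)` of `φ_x(t)` against the
kernel `K_n = ∑ a_{n,k} D_k`, so Minkowski's integral inequality bounds its norm by the integral of
`|K_n(t)| ‖φ_·(t)‖_p`. Since `sin (t/2) ≥ t/π`, membership in the class gives `‖φ_·(t)‖_p ≤ |M| ω(t)
(π/t)^β`. What remains is an estimate of one scalar integral.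

The kernel is controlled by Abel summation (`abs_sum_range_mul_le`): the sines `sin ((k + 1/2) t)`
have block sums at most `m + 1` when `t ≥ π/(m+1)`, and the variation condition turns this into
`|K_n(t)| ≪ (m+1) ∑_{k ≤ m} b_{n,k}`. Here `b_{n,k}` is `a_{n,k}` for MRBVS and the reversed row
`a_{n,n-k}` for MHBVS; after this substitution both cases are the same
(`exists_normLp_matrixMean_sub_le`).

On `(0, π/(n+1)]` the bound `|K_n| ≤ n + 1` suffices, because `t^(-β)` is integrable. On `(π/(m+1),
π/m]`, of length `O((m+1)^(-2))`, the integral is `O((m+1)^(β-1))` times `ω(π/(m+1)) ∑_{k ≤ m}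
b_{n,k}`. By monotonicity of `ω` this last product is at most the full weighted sum `∑ b_{n,k}
ω(π/(k+1))`. Summing over `m ≤ n` gives `(n+1)^β` for `β > 0`; for `β = 0` the harmonic sum is
dominated by the power `(n+1)^(1/p)`. -/

noncomputable section

namespace FourierMatrixMeans

/-! ### Dirichlet kernel and blocks of sines -/

/-- The Dirichlet kernel `D_k(t) = 1/2 + ∑_{ν=1}^k cos (ν t)`. -/
def dirichletKernel (k : ℕ) (t : ℝ) : ℝ := 1 / 2 + ∑ ν ∈ Finset.Icc 1 k, Real.cos (ν * t)

lemma continuous_dirichletKernel (k : ℕ) : Continuous (dirichletKernel k) := by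
  unfold dirichletKernel; fun_prop

lemma dirichletKernel_neg (k : ℕ) (t : ℝ) : dirichletKernel k (-t) = dirichletKernel k t := by
  simp [dirichletKernel]

lemma dirichletKernel_periodic (k : ℕ) : Function.Periodic (dirichletKernel k) (2 * Real.pi) := by
  intro t
  unfold dirichletKernel
  congr 1
  refine Finset.sum_congr rfl fun ν _ => ?_
  rw [mul_add]
  exact Real.cos_add_nat_mul_two_pi _ _

lemma abs_dirichletKernel_le (k : ℕ) (t : ℝ) : |dirichletKernel k t| ≤ k + 1 := by
  unfold dirichletKernel
  have h : |∑ ν ∈ Finset.Icc 1 k, Real.cos (ν * t)| ≤ k := by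
    calc _ ≤ ∑ ν ∈ Finset.Icc 1 k, |Real.cos (ν * t)| := Finset.abs_sum_le_sum_abs _ _
      _ ≤ ∑ ν ∈ Finset.Icc 1 k, (1 : ℝ) := Finset.sum_le_sum fun ν _ => Real.abs_cos_le_one _
      _ = k := by simp
  have := abs_add_le (1 / 2) (∑ ν ∈ Finset.Icc 1 k, Real.cos (ν * t))
  have h2 : |(1 / 2 : ℝ)| = 1 / 2 := by norm_num
  linarith

lemma two_sin_half_mul_dirichletKernel (k : ℕ) (t : ℝ) :
    2 * Real.sin (t / 2) * dirichletKernel k t = Real.sin ((k + 1 / 2) * t) := by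
  induction k with
  | zero => simp [dirichletKernel]; ring_nf
  | succ k ih =>
    have h : dirichletKernel (k + 1) t = dirichletKernel k t + Real.cos (((k + 1 : ℕ) : ℝ) * t) := by
      unfold dirichletKernel
      rw [Finset.sum_Icc_succ_top (by omega)]; ring
    rw [h, mul_add, ih, Real.two_mul_sin_mul_cos]
    push_cast
    have e1 : t / 2 - ((k : ℝ) + 1) * t = -((k + 1 / 2) * t) := by ring
    have e2 : t / 2 + ((k : ℝ) + 1) * t = (k + 1 + 1 / 2) * t := by ring
    rw [e1, e2, Real.sin_neg]; ring

lemma integral_dirichletKernel (k : ℕ) :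
    ∫ t in (0 : ℝ)..Real.pi, dirichletKernel k t = Real.pi / 2 := by
  unfold dirichletKernel
  rw [intervalIntegral.integral_add (by simp)
    (Continuous.intervalIntegrable (by fun_prop) _ _), intervalIntegral.integral_finsetSum
    (fun i _ => Continuous.intervalIntegrable (by fun_prop) _ _)]
  have : ∑ ν ∈ Finset.Icc 1 k, ∫ t in (0 : ℝ)..Real.pi, Real.cos (ν * t) = 0 := by
    refine Finset.sum_eq_zero fun ν hν => ?_
    have hν' : (ν : ℝ) ≠ 0 := by
      have := (Finset.mem_Icc.1 hν).1; positivity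
    rw [intervalIntegral.integral_comp_mul_left (fun t => Real.cos t) hν']
    simp [Real.sin_nat_mul_pi]
  rw [this]
  simp; ring

/-- Blocks of the sines `sin ((k + 1/2) t)` have bounded sums. -/
lemma abs_sum_Ico_sin_le {p q : ℕ} (hpq : p ≤ q) {t : ℝ} (ht : 0 < Real.sin (t / 2)) :
    |∑ k ∈ Finset.Ico p q, Real.sin ((k + 1 / 2) * t)| ≤ 1 / Real.sin (t / 2) := by
  have h : 2 * Real.sin (t / 2) * ∑ k ∈ Finset.Ico p q, Real.sin ((k + 1 / 2) * t)
      = Real.cos (p * t) - Real.cos (q * t) := by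
    rw [Finset.mul_sum]
    -- The product-to-sum formula makes each term a difference of consecutive cosines, so the sum
    -- telescopes.
    have : ∀ k ∈ Finset.Ico p q, 2 * Real.sin (t / 2) * Real.sin ((k + 1 / 2) * t)
        = -(Real.cos (((k + 1 : ℕ) : ℝ) * t) - Real.cos ((k : ℝ) * t)) := by
      intro k _
      rw [Real.two_mul_sin_mul_sin, ← Real.cos_neg (t / 2 - _)]
      push_cast; ring_nf
    rw [Finset.sum_congr rfl this, Finset.sum_neg_distrib,
      Finset.sum_Ico_sub (fun k : ℕ => Real.cos ((k : ℝ) * t)) hpq]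
    ring
  have h2 : |2 * Real.sin (t / 2) * ∑ k ∈ Finset.Ico p q, Real.sin ((k + 1 / 2) * t)| ≤ 2 := by
    rw [h]
    have h1 := Real.cos_le_one (p * t)
    have h2 := Real.cos_le_one (q * t)
    have h3 := Real.neg_one_le_cos (p * t)
    have h4 := Real.neg_one_le_cos (q * t)
    rw [abs_le]; constructor <;> linarith
  rw [abs_mul, abs_of_pos (by positivity)] at h2
  rw [le_div_iff₀ ht]
  linarith

/-! ### Abel summation against weights of controlled variation -/

/-- Abel summation: a bound for `∑_{k=m}^{n} b_k u_k` through the variation of `b`. -/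
lemma abs_sum_Ico_mul_le {b u : ℕ → ℝ} {m n : ℕ} {B : ℝ} (hmn : m ≤ n)
    (hu : ∀ q, m ≤ q → |∑ k ∈ Finset.Ico m q, u k| ≤ B) :
    |∑ k ∈ Finset.Ico m (n + 1), b k * u k| ≤
      B * (|b n| + ∑ k ∈ Finset.Ico m n, |b k - b (k + 1)|) := by
  have key : ∑ k ∈ Finset.Ico m (n + 1), b k * u k = b n * ∑ k ∈ Finset.Ico m (n + 1), u k +
      ∑ k ∈ Finset.Ico m n, (b k - b (k + 1)) * ∑ j ∈ Finset.Ico m (k + 1), u j := by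
    induction n, hmn using Nat.le_induction with
    | base => simp
    | succ n hmn ih =>
      rw [Finset.sum_Ico_succ_top (by omega), ih,
        Finset.sum_Ico_succ_top hmn (fun k => (b k - b (k + 1)) * ∑ j ∈ Finset.Ico m (k + 1), u j),
        Finset.sum_Ico_succ_top (show m ≤ n + 1 by omega) u]
      ring
  have hB : 0 ≤ B := (abs_nonneg _).trans (hu m le_rfl)
  rw [key]
  refine (abs_add_le _ _).trans ?_
  rw [mul_add, abs_mul, Finset.mul_sum, mul_comm B]
  gcongr
  · exact hu _ (by omega)
  · refine (Finset.abs_sum_le_sum_abs _ _).trans (Finset.sum_le_sum fun k hk => ?_)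
    rw [abs_mul, mul_comm]
    gcongr
    exact hu _ (by have := Finset.mem_Ico.1 hk; omega)

/-- Rows of mean rest bounded variation: estimate of `∑ b_k u_k` when `u` is bounded and has block
sums bounded by `m + 1`. -/
lemma abs_sum_range_mul_le {b u : ℕ → ℝ} {n : ℕ} {K : ℝ} (hK : 0 ≤ K)
    (hb : ∀ k ≤ n, 0 ≤ b k)
    (hvar : ∀ m, 1 ≤ m → m < n → ∑ k ∈ Finset.Ico m n, |b k - b (k + 1)| ≤
      K * (1 / ((m : ℝ) + 1)) * ∑ k ∈ Finset.range (m + 1), b k)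
    {m : ℕ} (hm : 1 ≤ m) (hmn : m ≤ n) (hu1 : ∀ k ≤ n, |u k| ≤ 1)
    (hu : ∀ q, m ≤ q → q ≤ n + 1 → |∑ k ∈ Finset.Ico m q, u k| ≤ m + 1) :
    |∑ k ∈ Finset.range (n + 1), b k * u k| ≤
      (3 + 4 * K) * ∑ k ∈ Finset.range (m + 1), b k := by
  set S := ∑ k ∈ Finset.range (m + 1), b k with hS
  have hS0 : 0 ≤ S := Finset.sum_nonneg fun k hk => hb k (by have := Finset.mem_range.1 hk; omega)
  have hhead : ∀ r ≤ m + 1, |∑ k ∈ Finset.range r, b k * u k| ≤ S := by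
    intro r hr
    calc _ ≤ ∑ k ∈ Finset.range r, |b k * u k| := Finset.abs_sum_le_sum_abs _ _
      _ ≤ ∑ k ∈ Finset.range r, b k := by
        refine Finset.sum_le_sum fun k hk => ?_
        have hk' : k ≤ n := by have := Finset.mem_range.1 hk; omega
        rw [abs_mul, abs_of_nonneg (hb k hk')]
        exact mul_le_of_le_one_right (hb k hk') (hu1 k hk')
      _ ≤ S := Finset.sum_le_sum_of_subset_of_nonneg
          (Finset.range_subset_range.2 hr) fun k hk _ =>
            hb k (by have := Finset.mem_range.1 hk; omega)
  -- For `m = n` there is no tail and the trivial bound `|u k| ≤ 1` is enough.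
  rcases eq_or_lt_of_le hmn with rfl | hlt
  · refine (hhead _ le_rfl).trans ?_
    nlinarith [mul_nonneg hK hS0]
  have hm0 : (0 : ℝ) < (m : ℝ) + 1 := by positivity
  -- variation from `h = ⌈m / 2⌉` on
  set h := (m + 1) / 2 with hh
  have hvarh : ∑ k ∈ Finset.Ico h n, |b k - b (k + 1)| ≤ 2 * K / (m + 1) * S := by
    refine (hvar h (by omega) (by omega)).trans ?_
    have h1 : K * (1 / ((h : ℝ) + 1)) ≤ 2 * K / (m + 1) := by
      rw [mul_one_div, div_le_div_iff₀ (by positivity) hm0]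
      have : (m : ℝ) + 1 ≤ 2 * (h + 1) := by
        have : m + 1 ≤ 2 * (h + 1) := by omega
        exact_mod_cast this
      nlinarith
    have h2 : ∑ k ∈ Finset.range (h + 1), b k ≤ S :=
      Finset.sum_le_sum_of_subset_of_nonneg (Finset.range_subset_range.2 (by omega))
        fun k hk _ => hb k (by have := Finset.mem_range.1 hk; omega)
    have h3 : 0 ≤ ∑ k ∈ Finset.range (h + 1), b k :=
      Finset.sum_nonneg fun k hk => hb k (by have := Finset.mem_range.1 hk; omega)
    exact mul_le_mul h1 h2 h3 (by positivity)
  have hbn : ∀ j ∈ Finset.Ico h (m + 1), b n ≤ b j + 2 * K / (m + 1) * S := by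
    intro j hj
    have hj' := Finset.mem_Ico.1 hj
    have h1 : b n - b j = ∑ k ∈ Finset.Ico j n, (b (k + 1) - b k) :=
      (Finset.sum_Ico_sub b (by omega)).symm
    have h2 : ∑ k ∈ Finset.Ico j n, (b (k + 1) - b k) ≤ ∑ k ∈ Finset.Ico h n, |b k - b (k + 1)| := by
      calc _ ≤ ∑ k ∈ Finset.Ico j n, |b k - b (k + 1)| :=
            Finset.sum_le_sum fun k _ => by rw [abs_sub_comm]; exact le_abs_self _
        _ ≤ _ := Finset.sum_le_sum_of_subset_of_nonneg
            (Finset.Ico_subset_Ico hj'.1 le_rfl) fun _ _ _ => abs_nonneg _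
    linarith
  -- Average the preceding bound over `j = h, ..., m`. Starting at half of `m` leaves at least `(m +
  -- 1) / 2` indices to average over, while the variation from `h` still costs only a factor 2.
  have hbn' : b n ≤ 2 / (m + 1) * S + 2 * K / (m + 1) * S := by
    have h1 := Finset.card_nsmul_le_sum (Finset.Ico h (m + 1))
      (fun j => b j + 2 * K / (m + 1) * S) (b n) hbn
    rw [Finset.sum_add_distrib, Finset.sum_const, Nat.card_Ico, nsmul_eq_mul, nsmul_eq_mul] at h1
    have h2 : ∑ j ∈ Finset.Ico h (m + 1), b j ≤ S :=
      Finset.sum_le_sum_of_subset_of_nonneg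
        (fun j hj => by simp only [Finset.mem_Ico, Finset.mem_range] at *; omega)
        fun k hk _ => hb k (by have := Finset.mem_range.1 hk; omega)
    set c : ℝ := ((m + 1 - h : ℕ) : ℝ) with hc
    have hc' : (m : ℝ) + 1 ≤ 2 * c := by
      have : m + 1 ≤ 2 * (m + 1 - h) := by omega
      rw [hc]; exact_mod_cast this
    have h3 : c * (b n - 2 * K / (m + 1) * S) ≤ S := by linarith
    have h4 : b n - 2 * K / (m + 1) * S ≤ 2 / (m + 1) * S := by
      rw [div_mul_eq_mul_div 2, le_div_iff₀ hm0]
      generalize b n - 2 * K / (m + 1) * S = y at h3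
      by_cases hneg : y ≤ 0
      · nlinarith
      · push Not at hneg
        nlinarith
    linarith
  -- The block bound on `u` is known only up to index `n`, so `u` is continued by zero.
  have htail := abs_sum_Ico_mul_le (b := b) (u := fun k => if k ≤ n then u k else 0)
    (m := m) (n := n) (B := m + 1) hmn (by
      intro q hq
      by_cases hqn : q ≤ n + 1
      · rw [Finset.sum_congr rfl (fun k hk => if_pos (by
          have := Finset.mem_Ico.1 hk; omega))]
        exact hu q hq hqn
      · rw [← Finset.sum_Ico_consecutive _ (show m ≤ n + 1 by omega) (by omega : n + 1 ≤ q),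
          Finset.sum_congr rfl (fun k hk => if_pos (by
          have := Finset.mem_Ico.1 hk; omega)),
          Finset.sum_eq_zero (s := Finset.Ico (n + 1) q) (fun k hk => if_neg (by
          have := Finset.mem_Ico.1 hk; omega)), add_zero]
        exact hu (n + 1) (by omega) le_rfl)
  rw [Finset.sum_congr rfl (fun k hk => by
    rw [if_pos (by have := Finset.mem_Ico.1 hk; omega)])] at htail
  have hvarm : ∑ k ∈ Finset.Ico m n, |b k - b (k + 1)| ≤ 2 * K / (m + 1) * S :=
    (Finset.sum_le_sum_of_subset_of_nonneg
      (Finset.Ico_subset_Ico (by omega) le_rfl) fun _ _ _ => abs_nonneg _).trans hvarh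
  rw [← Finset.sum_range_add_sum_Ico _ (show m ≤ n + 1 by omega)]
  refine (abs_add_le _ _).trans ?_
  have h5 := hhead m (by omega)
  rw [abs_of_nonneg (hb n le_rfl)] at htail
  -- The tail contributes `2 + 2K` from `b n` and `2K` from the variation; the head adds 1, whence
  -- `3 + 4K`.
  have h6 : ((m : ℝ) + 1) * (b n + ∑ k ∈ Finset.Ico m n, |b k - b (k + 1)|) ≤
      (m + 1) * ((2 / (m + 1) * S + 2 * K / (m + 1) * S) + 2 * K / (m + 1) * S) := by gcongr
  have h7 : ((m : ℝ) + 1) * ((2 / (m + 1) * S + 2 * K / (m + 1) * S) + 2 * K / (m + 1) * S)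
      = (2 + 4 * K) * S := by field_simp; ring
  linarith

/-! ### Minkowski's integral inequality -/

/-- Minkowski's integral inequality, for a positive bound `G` of the norms. -/
lemma lintegral_rpow_lintegral_le_of_ne_zero {X T : Type*} [MeasurableSpace X] [MeasurableSpace T]
    {μ : Measure X} {ν : Measure T} [SFinite μ] [SFinite ν] {p : ℝ} (hp : 1 < p)
    {F : X → T → ℝ≥0∞} (hF : AEMeasurable (Function.uncurry F) (μ.prod ν))
    {G : T → ℝ≥0∞} (hG : AEMeasurable G ν) (hG0 : ∀ t, G t ≠ 0)
    (hGt : ∫⁻ t, G t ∂ν ≠ ∞)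
    (h : ∀ᵐ t ∂ν, ∫⁻ x, F x t ^ p ∂μ ≤ G t ^ p) :
    ∫⁻ x, (∫⁻ t, F x t ∂ν) ^ p ∂μ ≤ (∫⁻ t, G t ∂ν) ^ p := by
  have hp0 : 0 < p := by linarith
  set q := Real.conjExponent p with hq
  have hpq : p.HolderConjugate q := .conjExponent hp
  have hq0 : 0 < q := hpq.symm.pos
  have hGtop : ∀ᵐ t ∂ν, G t ≠ ∞ := (ae_lt_top' hG hGt).mono fun t ht => ht.ne
  set J := ∫⁻ t, G t ∂ν with hJ
  have hexp : p / q = p - 1 := by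
    rw [hq, Real.conjExponent]; field_simp
  have hFx : ∀ᵐ x ∂μ, AEMeasurable (F x) ν := by
    have := hF.aestronglyMeasurable.prodMk_left
    filter_upwards [this] with x hx using hx.aemeasurable
  have hmeasFG : AEMeasurable (fun z : X × T => F z.1 z.2 ^ p * G z.2 ^ (1 - p)) (μ.prod ν) :=
    (hF.pow_const p).mul ((hG.comp_snd).pow_const _)
  have holder : ∀ᵐ x ∂μ, (∫⁻ t, F x t ∂ν) ^ p ≤
      J ^ (p - 1) * ∫⁻ t, F x t ^ p * G t ^ (1 - p) ∂ν := by
    filter_upwards [hFx] with x hx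
    -- Hölder's inequality is applied with the weight `G ^ (1 / q)`, chosen so that after exchanging
    -- integrals the factor `G ^ (1 - p)` reduces `G ^ p` to `G`. Dividing by the weight is where `G
    -- ≠ 0` matters.
    have h1 : ∫⁻ t, F x t ∂ν = ∫⁻ t, ((fun t => F x t * G t ^ (-(1 / q))) *
        fun t => G t ^ (1 / q)) t ∂ν := by
      refine lintegral_congr_ae ?_
      filter_upwards [hGtop] with t ht
      simp only [Pi.mul_apply]
      rw [mul_assoc, ← ENNReal.rpow_add _ _ (hG0 t) ht]
      simp
    have h2 := ENNReal.lintegral_mul_le_Lp_mul_Lq ν hpq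
      (f := fun t => F x t * G t ^ (-(1 / q))) (g := fun t => G t ^ (1 / q))
      (hx.mul (hG.pow_const _)) (hG.pow_const _)
    rw [← h1] at h2
    have h3 : ∫⁻ t, (G t ^ (1 / q)) ^ q ∂ν = J := by
      refine lintegral_congr fun t => ?_
      rw [← ENNReal.rpow_mul, one_div_mul_cancel hq0.ne', ENNReal.rpow_one]
    have h4 : ∫⁻ t, (F x t * G t ^ (-(1 / q))) ^ p ∂ν = ∫⁻ t, F x t ^ p * G t ^ (1 - p) ∂ν := by
      refine lintegral_congr fun t => ?_
      rw [ENNReal.mul_rpow_of_nonneg _ _ hp0.le, ← ENNReal.rpow_mul]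
      congr 2
      rw [neg_mul, one_div_mul_eq_div, hexp]; ring
    simp only [h3, h4] at h2
    calc (∫⁻ t, F x t ∂ν) ^ p ≤
        ((∫⁻ t, F x t ^ p * G t ^ (1 - p) ∂ν) ^ (1 / p) * J ^ (1 / q)) ^ p :=
          ENNReal.rpow_le_rpow h2 hp0.le
      _ = _ := by
        rw [ENNReal.mul_rpow_of_nonneg _ _ hp0.le, ← ENNReal.rpow_mul, ← ENNReal.rpow_mul,
          one_div_mul_cancel hp0.ne', ENNReal.rpow_one, one_div_mul_eq_div, hexp, mul_comm]
  calc ∫⁻ x, (∫⁻ t, F x t ∂ν) ^ p ∂μ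
      ≤ ∫⁻ x, J ^ (p - 1) * ∫⁻ t, F x t ^ p * G t ^ (1 - p) ∂ν ∂μ := lintegral_mono_ae holder
    _ = J ^ (p - 1) * ∫⁻ x, ∫⁻ t, F x t ^ p * G t ^ (1 - p) ∂ν ∂μ :=
        lintegral_const_mul' _ _ (ENNReal.rpow_ne_top_of_nonneg (by linarith) hGt)
    _ = J ^ (p - 1) * ∫⁻ t, ∫⁻ x, F x t ^ p * G t ^ (1 - p) ∂μ ∂ν := by
        rw [lintegral_lintegral_swap hmeasFG]
    _ ≤ J ^ (p - 1) * ∫⁻ t, G t ∂ν := by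
        gcongr 1
        refine lintegral_mono_ae ?_
        filter_upwards [h, hGtop] with t ht htop
        have hne : G t ^ (1 - p) ≠ ∞ := by
          simp [ENNReal.rpow_eq_top_iff, hG0 t, htop]
        rw [lintegral_mul_const' _ _ hne]
        calc _ ≤ G t ^ p * G t ^ (1 - p) := by gcongr
          _ = G t := by
            rw [← ENNReal.rpow_add _ _ (hG0 t) htop]; simp
    _ = J ^ p := by
        rw [← hJ]
        nth_rw 2 [← ENNReal.rpow_one J]
        rw [← ENNReal.rpow_add_of_nonneg _ _ (by linarith) zero_le_one]
        ring_nf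

/-- Minkowski's integral inequality over a finite parameter measure. -/
lemma rpow_lintegral_rpow_lintegral_le {X T : Type*} [MeasurableSpace X] [MeasurableSpace T]
    {μ : Measure X} {ν : Measure T} [SFinite μ] [IsFiniteMeasure ν] {p : ℝ} (hp : 1 < p)
    {F : X → T → ℝ≥0∞} (hF : AEMeasurable (Function.uncurry F) (μ.prod ν))
    {G : T → ℝ≥0∞} (hG : AEMeasurable G ν)
    (h : ∀ᵐ t ∂ν, ∫⁻ x, F x t ^ p ∂μ ≤ G t ^ p) :
    (∫⁻ x, (∫⁻ t, F x t ∂ν) ^ p ∂μ) ^ (1 / p) ≤ ∫⁻ t, G t ∂ν := by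
  have hp0 : 0 < p := by linarith
  by_cases hGt : ∫⁻ t, G t ∂ν = ∞
  · simp [hGt]
  -- Zeros of `G` are removed by adding `ε`; the cost `ε * ν univ` vanishes as `ε → 0` because `ν`
  -- is finite.
  have main : ∀ ε : ℝ≥0∞, ε ≠ 0 → ε ≠ ∞ →
      (∫⁻ x, (∫⁻ t, F x t ∂ν) ^ p ∂μ) ^ (1 / p) ≤ ∫⁻ t, G t ∂ν + ε * ν Set.univ := by
    intro ε hε hε'
    have hI : ∫⁻ t, (G t + ε) ∂ν = ∫⁻ t, G t ∂ν + ε * ν Set.univ := by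
      rw [lintegral_add_right _ measurable_const, lintegral_const]
    have h1 := lintegral_rpow_lintegral_le_of_ne_zero hp hF (G := fun t => G t + ε)
      (hG.add_const _) (fun t => by simp [hε])
      (by rw [hI]; exact ENNReal.add_ne_top.2
            ⟨hGt, ENNReal.mul_ne_top hε' (measure_ne_top _ _)⟩)
      (h.mono fun t ht => ht.trans (ENNReal.rpow_le_rpow le_self_add hp0.le))
    rw [← hI]
    calc _ ≤ ((∫⁻ t, (G t + ε) ∂ν) ^ p) ^ (1 / p) := ENNReal.rpow_le_rpow h1 (by positivity)
      _ = _ := by rw [← ENNReal.rpow_mul, mul_one_div_cancel hp0.ne', ENNReal.rpow_one]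
  have hlim : Filter.Tendsto (fun ε : ℝ≥0∞ => ∫⁻ t, G t ∂ν + ε * ν Set.univ)
      (nhdsWithin 0 (Set.Ioi 0)) (nhds (∫⁻ t, G t ∂ν + 0 * ν Set.univ)) := by
    refine Filter.Tendsto.mono_left ?_ nhdsWithin_le_nhds
    exact tendsto_const_nhds.add
      (ENNReal.Tendsto.mul_const Filter.tendsto_id (Or.inr (measure_ne_top _ _)))
  rw [zero_mul, add_zero] at hlim
  refine ge_of_tendsto hlim ?_
  have : Set.Ioo (0 : ℝ≥0∞) 1 ∈ nhdsWithin (0 : ℝ≥0∞) (Set.Ioi 0) :=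
    Ioo_mem_nhdsGT zero_lt_one
  filter_upwards [this] with ε hε
  exact main ε hε.1.ne' (hε.2.trans ENNReal.one_lt_top).ne

/-! ### Integral representation of the deviation -/

lemma intervalIntegrable_of_mem_periodicLp {p : ℝ} (hp : 1 ≤ p) {f : ℝ → ℝ}
    (hf : f ∈ periodicLp p) (a b : ℝ) : IntervalIntegrable f volume a b := by
  have h1 : Integrable f periodMeasure := by
    have : IsFiniteMeasure periodMeasure := by unfold periodMeasure; infer_instance
    exact hf.2.integrable (by simpa using hp)
  have h2 : IntervalIntegrable f volume (-Real.pi) (-Real.pi + 2 * Real.pi) := by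
    rw [intervalIntegrable_iff_integrableOn_Icc_of_le (by linarith [Real.pi_pos])]
    have : -Real.pi + 2 * Real.pi = Real.pi := by ring
    rw [this]
    exact h1
  exact hf.1.intervalIntegrable Real.two_pi_pos.ne' h2 a b

lemma aestronglyMeasurable_of_mem_periodicLp {p : ℝ} (hp : 1 ≤ p) {f : ℝ → ℝ}
    (hf : f ∈ periodicLp p) : AEStronglyMeasurable f volume := by
  have : LocallyIntegrable f volume := by
    intro x
    refine ⟨Set.Icc (x - 1) (x + 1), Icc_mem_nhds (by linarith) (by linarith), ?_⟩
    have := intervalIntegrable_of_mem_periodicLp hp hf (x - 1) (x + 1)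
    rwa [intervalIntegrable_iff_integrableOn_Icc_of_le (by linarith)] at this
  exact this.aestronglyMeasurable

lemma partialSum_eq_integral_mul_dirichletKernel {f : ℝ → ℝ}
    (hf : ∀ a b, IntervalIntegrable f volume a b) (k : ℕ) (x : ℝ) :
    partialSum f k x = (1 / Real.pi) *
      ∫ t in (-Real.pi)..Real.pi, f t * dirichletKernel k (t - x) := by
  have hint : ∀ g : ℝ → ℝ, Continuous g →
      IntervalIntegrable (fun t => f t * g t) volume (-Real.pi) Real.pi :=
    fun g hg => (hf _ _).mul_continuousOn hg.continuousOn
  have h0 : cosCoeff f 0 / 2 = (1 / Real.pi) * ∫ t in (-Real.pi)..Real.pi, f t * (1 / 2) := by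
    simp only [cosCoeff, Nat.cast_zero, zero_mul, Real.cos_zero, mul_one,
      intervalIntegral.integral_mul_const]
    ring
  have hν : ∀ ν : ℕ, cosCoeff f ν * Real.cos (ν * x) + sinCoeff f ν * Real.sin (ν * x) =
      (1 / Real.pi) * ∫ t in (-Real.pi)..Real.pi, f t * Real.cos (ν * (t - x)) := by
    intro ν
    have : ∀ t, f t * Real.cos (ν * (t - x)) = f t * Real.cos (ν * t) * Real.cos (ν * x) +
        f t * Real.sin (ν * t) * Real.sin (ν * x) := by
      intro t
      rw [mul_sub, Real.cos_sub]; ring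
    simp only [this]
    rw [intervalIntegral.integral_add ((hint _ (by fun_prop)).mul_const _)
      ((hint _ (by fun_prop)).mul_const _), intervalIntegral.integral_mul_const,
      intervalIntegral.integral_mul_const, cosCoeff, sinCoeff]
    ring
  unfold partialSum dirichletKernel
  rw [h0, Finset.sum_congr rfl (fun ν _ => hν ν), ← Finset.mul_sum, ← mul_add,
    ← intervalIntegral.integral_finsetSum (fun ν _ => hint _ (by fun_prop)),
    ← intervalIntegral.integral_add (hint _ continuous_const)
      (by
        simp only [← Finset.mul_sum]
        exact hint _ (by fun_prop))]
  simp only [mul_add, Finset.mul_sum]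

lemma partialSum_eq_integral_add_mul_dirichletKernel {f : ℝ → ℝ}
    (hper : Function.Periodic f (2 * Real.pi))
    (hf : ∀ a b, IntervalIntegrable f volume a b) (k : ℕ) (x : ℝ) :
    partialSum f k x = (1 / Real.pi) *
      ∫ t in (0 : ℝ)..Real.pi, (f (x + t) + f (x - t)) * dirichletKernel k t := by
  rw [partialSum_eq_integral_mul_dirichletKernel hf]
  congr 1
  have hD := continuous_dirichletKernel k
  have h1 : ∫ t in (-Real.pi)..Real.pi, f t * dirichletKernel k (t - x) =
      ∫ t in (x + -Real.pi)..(x + Real.pi), f t * dirichletKernel k (t - x) := by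
    have hp : Function.Periodic (fun t => f t * dirichletKernel k (t - x)) (2 * Real.pi) := by
      intro t
      simp only
      rw [hper t, show t + 2 * Real.pi - x = t - x + 2 * Real.pi by ring,
        dirichletKernel_periodic k (t - x)]
    have := hp.intervalIntegral_add_eq (-Real.pi) (x + -Real.pi)
    convert this using 2 <;> ring
  have h2 : ∫ t in (x + -Real.pi)..(x + Real.pi), f t * dirichletKernel k (t - x) =
      ∫ t in (-Real.pi)..Real.pi, f (x + t) * dirichletKernel k t := by
    rw [← intervalIntegral.integral_comp_add_left (fun t => f t * dirichletKernel k (t - x))]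
    simp
  have hi : ∀ a b, IntervalIntegrable (fun t => f (x + t) * dirichletKernel k t) volume a b := by
    intro a b
    refine IntervalIntegrable.mul_continuousOn ?_ hD.continuousOn
    have := (hf (x + a) (x + b)).comp_add_left x
    simpa using this
  have hi' : IntervalIntegrable (fun t => f (x - t) * dirichletKernel k t) volume 0 Real.pi := by
    refine IntervalIntegrable.mul_continuousOn ?_ hD.continuousOn
    have := (hf (x - 0) (x - Real.pi)).comp_sub_left x
    simpa using this
  -- Evenness of the kernel folds the negative half of the period onto `(0, π)`.
  have h3 : ∫ t in (-Real.pi)..0, f (x + t) * dirichletKernel k t =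
      ∫ t in (0 : ℝ)..Real.pi, f (x - t) * dirichletKernel k t := by
    have := intervalIntegral.integral_comp_neg (a := 0) (b := Real.pi)
      (fun t => f (x + t) * dirichletKernel k t)
    rw [neg_zero] at this
    rw [← this]
    simp only [dirichletKernel_neg, sub_eq_add_neg]
  rw [h1, h2, ← intervalIntegral.integral_add_adjacent_intervals (hi _ 0) (hi 0 _), h3]
  simp only [add_mul]
  rw [intervalIntegral.integral_add (hi _ _) hi', add_comm]

/-- The kernel `∑_{k=0}^n a_{n,k} D_k` of the matrix mean `T_{n,A}`. -/
def meanKernel (a : ℕ → ℕ → ℝ) (n : ℕ) (t : ℝ) : ℝ :=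
  ∑ k ∈ Finset.range (n + 1), a n k * dirichletKernel k t

lemma continuous_meanKernel (a : ℕ → ℕ → ℝ) (n : ℕ) : Continuous (meanKernel a n) := by
  have := continuous_dirichletKernel
  unfold meanKernel; fun_prop

/-- Because `D_k` has integral `π/2` over `(0, π)`, the value `f x` can be moved under the integral
for each `k`; unit row sums carry this over to the mean. -/
lemma matrixMean_sub_eq_integral {f : ℝ → ℝ} (hper : Function.Periodic f (2 * Real.pi))
    (hf : ∀ a b, IntervalIntegrable f volume a b) {a : ℕ → ℕ → ℝ} (ha : IsMeanMatrix a)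
    (n : ℕ) (x : ℝ) :
    matrixMean a n f x - f x =
      (1 / Real.pi) * ∫ t in (0 : ℝ)..Real.pi, phi f x t * meanKernel a n t := by
  have hphi : IntervalIntegrable (phi f x) volume 0 Real.pi := by
    have h1 := (hf (x + 0) (x + Real.pi)).comp_add_left x
    have h2 := (hf (x - 0) (x - Real.pi)).comp_sub_left x
    simp only [sub_sub_cancel, add_sub_cancel_left] at h1 h2
    exact (h1.add h2).sub intervalIntegrable_const
  have hk : ∀ k, partialSum f k x - f x =
      (1 / Real.pi) * ∫ t in (0 : ℝ)..Real.pi, phi f x t * dirichletKernel k t := by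
    intro k
    have hD := (continuous_dirichletKernel k).intervalIntegrable (μ := volume) 0 Real.pi
    have h1 : ∀ t, (f (x + t) + f (x - t)) * dirichletKernel k t =
        phi f x t * dirichletKernel k t + 2 * f x * dirichletKernel k t := by
      intro t; unfold phi; ring
    rw [partialSum_eq_integral_add_mul_dirichletKernel hper hf]
    simp only [h1]
    rw [intervalIntegral.integral_add
      (hphi.mul_continuousOn (continuous_dirichletKernel k).continuousOn) (hD.const_mul _),
      intervalIntegral.integral_const_mul, integral_dirichletKernel]
    field_simp
    ring
  have h2 : matrixMean a n f x - f x =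
      ∑ k ∈ Finset.range (n + 1), a n k * (partialSum f k x - f x) := by
    simp only [mul_sub, Finset.sum_sub_distrib, ← Finset.sum_mul, ha.sum_eq_one, one_mul]
    rfl
  rw [h2]
  simp only [hk, meanKernel, Finset.mul_sum]
  rw [intervalIntegral.integral_finsetSum, Finset.mul_sum]
  · refine Finset.sum_congr rfl fun k _ => ?_
    rw [mul_left_comm, ← intervalIntegral.integral_const_mul]
    congr 2; ext t; ring
  · intro k _
    exact hphi.mul_continuousOn (by have := continuous_dirichletKernel k; fun_prop)

/-- The maps `(x, t) ↦ x ± t` pull null sets back to null sets, so joint measurability survives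
although `f` is only a.e. measurable. Exchanging integrals in Minkowski's inequality needs this. -/
lemma aestronglyMeasurable_phi {f : ℝ → ℝ} (hf : AEStronglyMeasurable f volume) :
    AEStronglyMeasurable (fun z : ℝ × ℝ => phi f z.1 z.2) (volume.prod volume) := by
  have h1 := hf.comp_quasiMeasurePreserving
    (quasiMeasurePreserving_add (μ := (volume : Measure ℝ)) (ν := volume))
  have h2 := hf.comp_quasiMeasurePreserving
    (quasiMeasurePreserving_sub (μ := (volume : Measure ℝ)) (ν := volume))
  exact (h1.add h2).sub (hf.comp_fst.const_mul 2)

/-- The deviation of the matrix mean, estimated through the norms of the second differences. -/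
lemma normLp_matrixMean_sub_le {p : ℝ} (hp : 1 < p) {f : ℝ → ℝ} (hf : f ∈ periodicLp p)
    {a : ℕ → ℕ → ℝ} (ha : IsMeanMatrix a) (n : ℕ) {G : ℝ → ℝ≥0∞}
    (hG : AEMeasurable G (volume.restrict (Set.Ioc 0 Real.pi)))
    (h : ∀ t ∈ Set.Ioc 0 Real.pi,
      ENNReal.ofReal |meanKernel a n t| * normLp p (fun x => phi f x t) ≤ G t) :
    normLp p (fun x => matrixMean a n f x - f x) ≤ ∫⁻ t in Set.Ioc 0 Real.pi, G t := by
  have hp0 : 0 < p := by linarith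
  have hnorm : ∀ g : ℝ → ℝ, normLp p g = (∫⁻ x, ‖g x‖ₑ ^ p ∂periodMeasure) ^ (1 / p) := by
    intro g
    rw [normLp, eLpNorm_eq_lintegral_rpow_enorm_toReal (by simpa using hp0) (by simp),
      ENNReal.toReal_ofReal hp0.le]
  have hint := intervalIntegrable_of_mem_periodicLp hp.le hf
  set ν := (volume : Measure ℝ).restrict (Set.Ioc 0 Real.pi) with hν
  have hmeas : AEMeasurable
      (Function.uncurry fun x t => ‖phi f x t * meanKernel a n t‖ₑ) (periodMeasure.prod ν) := by
    have h1 := aestronglyMeasurable_phi (aestronglyMeasurable_of_mem_periodicLp hp.le hf)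
    have h2 : AEStronglyMeasurable (fun z : ℝ × ℝ => phi f z.1 z.2) (periodMeasure.prod ν) := by
      rw [periodMeasure, hν, Measure.prod_restrict]
      exact h1.restrict
    have h3 : Continuous fun z : ℝ × ℝ => meanKernel a n z.2 :=
      (continuous_meanKernel a n).comp continuous_snd
    exact (h2.mul h3.aestronglyMeasurable).enorm
  have : SFinite periodMeasure := by unfold periodMeasure; infer_instance
  have key := rpow_lintegral_rpow_lintegral_le hp hmeas hG (by
    rw [hν]
    filter_upwards [ae_restrict_mem measurableSet_Ioc] with t ht
    have h1 := h t ht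
    rw [hnorm] at h1
    have h2 := ENNReal.rpow_le_rpow h1 hp0.le
    rw [ENNReal.mul_rpow_of_nonneg _ _ hp0.le, ← ENNReal.rpow_mul, one_div_mul_cancel hp0.ne',
      ENNReal.rpow_one] at h2
    refine le_trans (le_of_eq ?_) h2
    rw [← lintegral_const_mul' _ _ (ENNReal.rpow_ne_top_of_nonneg hp0.le ENNReal.ofReal_ne_top)]
    refine lintegral_congr fun x => ?_
    rw [enorm_mul, ENNReal.mul_rpow_of_nonneg _ _ hp0.le, mul_comm, ← Real.enorm_eq_ofReal_abs])
  refine le_trans ?_ key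
  rw [hnorm]
  gcongr with x
  rw [matrixMean_sub_eq_integral hf.1 hint ha, enorm_mul]
  -- The factor `1/π` is simply discarded.
  have hpi : ‖1 / Real.pi‖ₑ ≤ 1 := by
    rw [Real.enorm_eq_ofReal (by positivity)]
    refine ENNReal.ofReal_le_one.2 ?_
    rw [div_le_one Real.pi_pos]; linarith [Real.pi_gt_three]
  calc _ ≤ 1 * ‖∫ t in (0 : ℝ)..Real.pi, phi f x t * meanKernel a n t‖ₑ := by gcongr
    _ ≤ _ := by
      rw [one_mul, intervalIntegral.integral_of_le Real.pi_pos.le]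
      exact enorm_integral_le_lintegral_enorm _

/-! ### Elementary bounds for the modulus, the powers and the kernel -/

lemma IsModulusType.nonneg {ω : ℝ → ℝ} (hω : IsModulusType ω) {t : ℝ} (h0 : 0 ≤ t)
    (h1 : t ≤ 2 * Real.pi) : 0 ≤ ω t := by
  have := hω.monotoneOn ⟨le_rfl, Real.two_pi_pos.le⟩ ⟨h0, h1⟩ h0
  rwa [hω.map_zero] at this

lemma IsModulusType.two_mul_le {ω : ℝ → ℝ} (hω : IsModulusType ω) {t : ℝ} (h0 : 0 ≤ t)
    (h1 : t ≤ Real.pi) : ω (2 * t) ≤ 2 * ω t := by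
  have := hω.subadditive t t h0 le_rfl (by linarith)
  rw [two_mul, two_mul]; exact this

lemma div_pi_le_sin_half {t : ℝ} (h0 : 0 ≤ t) (h1 : t ≤ Real.pi) :
    t / Real.pi ≤ Real.sin (t / 2) := by
  have := Real.mul_le_sin (x := t / 2) (by linarith) (by linarith)
  refine le_trans (le_of_eq ?_) this
  ring

/-- The induction step is Bernoulli's inequality for exponents in `(0, 1]`, applied to `n + 1 = y (1
- 1/y)` with `y = n + 2`. The factor `1 / γ` blows up as `γ → 0`, so the exponent `γ = 0` needs
separate treatment. -/
lemma sum_range_rpow_sub_one_le {γ : ℝ} (h0 : 0 < γ) (h1 : γ ≤ 1) (n : ℕ) :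
    ∑ m ∈ Finset.range (n + 1), ((m : ℝ) + 1) ^ (γ - 1) ≤ 1 / γ * ((n : ℝ) + 1) ^ γ := by
  induction n with
  | zero => simp; exact one_le_inv_iff₀.2 ⟨h0, h1⟩
  | succ n ih =>
    rw [Finset.sum_range_succ]
    push_cast
    set y : ℝ := (n : ℝ) + 1 + 1 with hy
    have hy0 : 0 < y := by positivity
    have hy1 : 1 ≤ y := by rw [hy]; linarith [(Nat.cast_nonneg n : (0 : ℝ) ≤ n)]
    have h2 : (n : ℝ) + 1 = y * (1 + -(1 / y)) := by rw [hy]; field_simp; ring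
    have hle : -1 ≤ -(1 / y) := by
      rw [neg_le_neg_iff, div_le_one hy0]; exact hy1
    have h3 := rpow_one_add_le_one_add_mul_self hle h0.le h1
    have h4 : ((n : ℝ) + 1) ^ γ ≤ y ^ γ * (1 + γ * -(1 / y)) := by
      rw [h2, Real.mul_rpow hy0.le (by linarith)]
      gcongr
    have h5 : y ^ (γ - 1) = y ^ γ / y := by rw [Real.rpow_sub_one hy0.ne']
    calc _ ≤ 1 / γ * ((n : ℝ) + 1) ^ γ + y ^ (γ - 1) := by linarith
      _ ≤ 1 / γ * (y ^ γ * (1 + γ * -(1 / y))) + y ^ (γ - 1) := by gcongr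
      _ = _ := by rw [h5]; field_simp; ring

lemma lintegral_Ioc_le_sum (G : ℝ → ℝ≥0∞) (n : ℕ) :
    ∫⁻ t in Set.Ioc 0 Real.pi, G t ≤ (∫⁻ t in Set.Ioc 0 (Real.pi / ((n : ℝ) + 1)), G t) +
      ∑ m ∈ Finset.Icc 1 n,
        ∫⁻ t in Set.Ioc (Real.pi / ((m : ℝ) + 1)) (Real.pi / (m : ℝ)), G t := by
  induction n with
  | zero => simp
  | succ n ih =>
    refine ih.trans ?_
    rw [Finset.sum_Icc_succ_top (by omega), add_comm (∑ m ∈ Finset.Icc 1 n, _), ← add_assoc]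
    gcongr
    refine le_trans (lintegral_mono_set ?_) (lintegral_union_le _ _ _)
    push_cast
    intro t ht
    rcases le_or_gt t (Real.pi / ((n : ℝ) + 1 + 1)) with h | h
    · exact Or.inl ⟨ht.1, h⟩
    · exact Or.inr ⟨h, ht.2⟩

/-- The supremum in the modulus at `δ = t` includes `t` itself, and `sin (t/2) ≥ t/π` allows
division by the sine factor. The absolute value of `M` appears because its sign is not prescribed.
-/
lemma normLp_phi_le {p β M : ℝ} {ω f : ℝ → ℝ} (hβ : 0 ≤ β) (hω : IsModulusType ω)
    (hM : ∀ δ ∈ Set.Icc 0 (2 * Real.pi), genModulus p β f δ ≤ ENNReal.ofReal (M * ω δ))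
    {t : ℝ} (ht : t ∈ Set.Ioc 0 Real.pi) :
    normLp p (fun x => phi f x t) ≤ ENNReal.ofReal (|M| * ω t * (Real.pi / t) ^ β) := by
  have ht0 := ht.1
  have hs := div_pi_le_sin_half ht0.le ht.2
  have hpos : 0 < t / Real.pi := div_pos ht0 Real.pi_pos
  have h1 : ENNReal.ofReal (|Real.sin (t / 2)| ^ β) * normLp p (fun x => phi f x t) ≤
      genModulus p β f t := by
    unfold genModulus
    exact le_iSup₂_of_le t (abs_of_pos ht0).le le_rfl
  have hω0 := hω.nonneg ht0.le (by linarith [ht.2, Real.pi_pos])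
  have h2 : ENNReal.ofReal ((t / Real.pi) ^ β) * normLp p (fun x => phi f x t) ≤
      ENNReal.ofReal (|M| * ω t) := by
    calc _ ≤ ENNReal.ofReal (|Real.sin (t / 2)| ^ β) * normLp p (fun x => phi f x t) := by
          gcongr
          exact hs.trans (le_abs_self _)
      _ ≤ ENNReal.ofReal (M * ω t) := h1.trans (hM t ⟨ht0.le, by linarith [ht.2, Real.pi_pos]⟩)
      _ ≤ _ := by gcongr; exact le_abs_self M
  have hinv : (Real.pi / t) ^ β * (t / Real.pi) ^ β = 1 := by
    rw [← Real.mul_rpow (by positivity) (by positivity)]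
    have : Real.pi / t * (t / Real.pi) = 1 := by field_simp
    rw [this, Real.one_rpow]
  calc normLp p (fun x => phi f x t)
      = ENNReal.ofReal ((Real.pi / t) ^ β) *
          (ENNReal.ofReal ((t / Real.pi) ^ β) * normLp p (fun x => phi f x t)) := by
        rw [← mul_assoc, ← ENNReal.ofReal_mul (by positivity), hinv, ENNReal.ofReal_one, one_mul]
    _ ≤ ENNReal.ofReal ((Real.pi / t) ^ β) * ENNReal.ofReal (|M| * ω t) := by gcongr
    _ = _ := by rw [← ENNReal.ofReal_mul (by positivity)]; ring_nf

lemma abs_meanKernel_le {a : ℕ → ℕ → ℝ} (ha : IsMeanMatrix a) (n : ℕ) (t : ℝ) :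
    |meanKernel a n t| ≤ n + 1 := by
  calc _ ≤ ∑ k ∈ Finset.range (n + 1), |a n k * dirichletKernel k t| :=
        Finset.abs_sum_le_sum_abs _ _
    _ ≤ ∑ k ∈ Finset.range (n + 1), a n k * ((n : ℝ) + 1) := by
      refine Finset.sum_le_sum fun k hk => ?_
      have hk' : k ≤ n := by have := Finset.mem_range.1 hk; omega
      rw [abs_mul, abs_of_nonneg (ha.nonneg n k hk')]
      refine mul_le_mul_of_nonneg_left ((abs_dirichletKernel_le k t).trans ?_) (ha.nonneg n k hk')
      have : (k : ℝ) ≤ n := by exact_mod_cast hk'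
      linarith
    _ = n + 1 := by rw [← Finset.sum_mul, ha.sum_eq_one, one_mul]

lemma two_sin_half_mul_meanKernel (a : ℕ → ℕ → ℝ) (n : ℕ) (t : ℝ) :
    2 * Real.sin (t / 2) * meanKernel a n t =
      ∑ k ∈ Finset.range (n + 1), a n k * Real.sin ((k + 1 / 2) * t) := by
  rw [meanKernel, Finset.mul_sum]
  refine Finset.sum_congr rfl fun k _ => ?_
  rw [← two_sin_half_mul_dirichletKernel]; ring

lemma lintegral_Ioc_rpow_neg {β s : ℝ} (hβ : β < 1) (hs : 0 < s) :
    ∫⁻ t in Set.Ioc 0 s, ENNReal.ofReal (t ^ (-β)) = ENNReal.ofReal (s ^ (1 - β) / (1 - β)) := by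
  have hi : IntervalIntegrable (fun t : ℝ => t ^ (-β)) volume 0 s :=
    intervalIntegral.intervalIntegrable_rpow' (by linarith)
  rw [← ofReal_integral_eq_lintegral_ofReal hi.1 (by
    filter_upwards [ae_restrict_mem measurableSet_Ioc] with t ht
    exact Real.rpow_nonneg ht.1.le _), ← intervalIntegral.integral_of_le hs.le,
    integral_rpow (Or.inl (by linarith))]
  rw [show -β + 1 = 1 - β by ring, Real.zero_rpow (by linarith), sub_zero]

/-! ### The deviation estimate from a kernel bound -/

/-- The deviation of a matrix mean whose kernel is controlled by the partial sums of the weights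
`b n k`. -/
theorem exists_normLp_matrixMean_sub_le {p β γ C₀ : ℝ} (hp : 1 < p) (hβ0 : 0 ≤ β) (hβ1 : β < 1)
    (hγ0 : 0 < γ) (hγ1 : γ ≤ 1) (hβγ : β ≤ γ) (hC₀ : 0 ≤ C₀) {ω f : ℝ → ℝ}
    (hω : IsModulusType ω) (hf : f ∈ classLpOmega p β ω) {a b : ℕ → ℕ → ℝ}
    (ha : IsMeanMatrix a) (hb0 : ∀ n k, k ≤ n → 0 ≤ b n k)
    (hb1 : ∀ n, ∑ k ∈ Finset.range (n + 1), b n k = 1)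
    (hker : ∀ n m : ℕ, 1 ≤ m → m ≤ n → ∀ t, Real.pi / ((m : ℝ) + 1) ≤ t → t ≤ Real.pi →
      |∑ k ∈ Finset.range (n + 1), a n k * Real.sin ((k + 1 / 2) * t)| ≤
        C₀ * ∑ k ∈ Finset.range (m + 1), b n k) :
    ∃ C : ℝ, ∀ n : ℕ, normLp p (fun x => matrixMean a n f x - f x) ≤
      ENNReal.ofReal (C * (((n : ℝ) + 1) ^ γ *
        ∑ k ∈ Finset.range (n + 1), b n k * ω (Real.pi / ((k : ℝ) + 1)))) := by
  obtain ⟨hfp, M, hM⟩ := hf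
  have hpi := Real.pi_pos
  -- The first term comes from `(0, π/(n+1)]`. In the second, 4 is the product of the doubling
  -- constant of `ω` and of the factor 2 in the interval length, and `1 / γ` comes from the sum of
  -- powers.
  refine ⟨|M| * (Real.pi / (1 - β)) + 4 * Real.pi * C₀ * |M| * (1 / γ), fun n => ?_⟩
  set Ω := ∑ k ∈ Finset.range (n + 1), b n k * ω (Real.pi / ((k : ℝ) + 1)) with hΩ
  have harg : ∀ k : ℕ, Real.pi / ((k : ℝ) + 1) ∈ Set.Icc 0 Real.pi := fun k =>
    ⟨by positivity, div_le_self hpi.le (by linarith [(Nat.cast_nonneg k : (0 : ℝ) ≤ k)])⟩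
  have harg2 : ∀ k : ℕ, Real.pi / ((k : ℝ) + 1) ∈ Set.Icc 0 (2 * Real.pi) := fun k =>
    ⟨(harg k).1, by linarith [(harg k).2]⟩
  have hω0 : ∀ k : ℕ, 0 ≤ ω (Real.pi / ((k : ℝ) + 1)) := fun k =>
    hω.nonneg (harg2 k).1 (harg2 k).2
  -- As `ω` is nondecreasing, `ω (π/(m+1)) ≤ ω (π/(k+1))` for `k ≤ m`; the rest of `Ω` is
  -- nonnegative.
  have hΩm : ∀ m ≤ n, ω (Real.pi / ((m : ℝ) + 1)) * ∑ k ∈ Finset.range (m + 1), b n k ≤ Ω := by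
    intro m hm
    rw [Finset.mul_sum]
    calc _ ≤ ∑ k ∈ Finset.range (m + 1), b n k * ω (Real.pi / ((k : ℝ) + 1)) := by
          refine Finset.sum_le_sum fun k hk => ?_
          have hk' := Finset.mem_range.1 hk
          rw [mul_comm]
          refine mul_le_mul_of_nonneg_left ?_ (hb0 n k (by omega))
          refine hω.monotoneOn (harg2 m) (harg2 k) ?_
          have : (k : ℝ) ≤ m := by exact_mod_cast Nat.lt_succ_iff.1 hk'
          gcongr
      _ ≤ Ω := Finset.sum_le_sum_of_subset_of_nonneg (Finset.range_subset_range.2 (by omega))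
          fun k hk _ => mul_nonneg (hb0 n k (by have := Finset.mem_range.1 hk; omega)) (hω0 k)
  have hΩ0 : 0 ≤ Ω := Finset.sum_nonneg fun k hk =>
    mul_nonneg (hb0 n k (by have := Finset.mem_range.1 hk; omega)) (hω0 k)
  set W : ℝ → ℝ := fun t => |meanKernel a n t| * (|M| * ω t * (Real.pi / t) ^ β) with hW
  have hWc : ContinuousOn W (Set.Ioc 0 Real.pi) := by
    refine (continuous_meanKernel a n).continuousOn.abs.mul ((ContinuousOn.mul continuousOn_const
      (hω.continuousOn.mono fun t ht => ⟨ht.1.le, by linarith [ht.2]⟩)).mul ?_)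
    refine ContinuousOn.rpow_const ?_ fun t _ => Or.inr hβ0
    exact continuousOn_const.div continuousOn_id fun t ht => ht.1.ne'
  have hmain := normLp_matrixMean_sub_le hp hfp ha n (G := fun t => ENNReal.ofReal (W t))
    (hWc.aemeasurable measurableSet_Ioc).ennreal_ofReal (by
      intro t ht
      rw [hW]
      simp only
      rw [ENNReal.ofReal_mul (abs_nonneg _)]
      gcongr
      exact normLp_phi_le hβ0 hω hM ht)
  refine hmain.trans ((lintegral_Ioc_le_sum _ n).trans ?_)
  -- Near zero `|K_n| ≤ n + 1` and `ω t ≤ ω (π/(n+1))`; integrating `t ^ (-β)` leaves `(n+1)^β ω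
  -- (π/(n+1))`, which unit sums of `b` place below `(n+1)^β Ω`.
  have hfirst : ∫⁻ t in Set.Ioc 0 (Real.pi / ((n : ℝ) + 1)), ENNReal.ofReal (W t) ≤
      ENNReal.ofReal (|M| * (Real.pi / (1 - β)) * (((n : ℝ) + 1) ^ γ * Ω)) := by
    set N : ℝ := (n : ℝ) + 1 with hN
    have hN0 : 0 < N := by positivity
    have hN1 : 1 ≤ N := by rw [hN]; linarith [(Nat.cast_nonneg n : (0 : ℝ) ≤ n)]
    set c : ℝ := N * (|M| * ω (Real.pi / N) * Real.pi ^ β) with hc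
    have hωN : 0 ≤ ω (Real.pi / N) := hω0 n
    have hc0 : 0 ≤ c := by positivity
    calc _ ≤ ∫⁻ t in Set.Ioc 0 (Real.pi / N), ENNReal.ofReal c * ENNReal.ofReal (t ^ (-β)) := by
          refine setLIntegral_mono' measurableSet_Ioc fun t ht => ?_
          rw [← ENNReal.ofReal_mul hc0]
          refine ENNReal.ofReal_le_ofReal ?_
          have h1 : ω t ≤ ω (Real.pi / N) := hω.monotoneOn
            ⟨ht.1.le, ht.2.trans (harg2 n).2⟩ (harg2 n) ht.2
          have h2 : (Real.pi / t) ^ β = Real.pi ^ β * t ^ (-β) := by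
            rw [Real.div_rpow hpi.le ht.1.le, Real.rpow_neg ht.1.le, div_eq_mul_inv]
          have ht0 := ht.1.le
          have h3 := abs_meanKernel_le ha n t
          have h4 : 0 ≤ ω t := hω.nonneg ht0 (ht.2.trans (harg2 n).2)
          calc W t = |meanKernel a n t| * (|M| * ω t * (Real.pi ^ β * t ^ (-β))) := by
                rw [hW]; simp only [h2]
            _ ≤ N * (|M| * ω (Real.pi / N) * (Real.pi ^ β * t ^ (-β))) := by gcongr
            _ = _ := by rw [hc]; ring
      _ = ENNReal.ofReal (c * ((Real.pi / N) ^ (1 - β) / (1 - β))) := by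
          rw [lintegral_const_mul' _ _ ENNReal.ofReal_ne_top,
            lintegral_Ioc_rpow_neg hβ1 (by positivity), ← ENNReal.ofReal_mul hc0]
      _ ≤ _ := by
          refine ENNReal.ofReal_le_ofReal ?_
          have e1 : Real.pi ^ β * Real.pi ^ (1 - β) = Real.pi := by
            rw [← Real.rpow_add hpi]; simp
          have e2 : N / N ^ (1 - β) = N ^ β := by
            rw [div_eq_iff (by positivity), ← Real.rpow_add hN0]; simp
          have e3 : c * ((Real.pi / N) ^ (1 - β) / (1 - β)) =
              |M| * (Real.pi / (1 - β)) * (N ^ β * ω (Real.pi / N)) := by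
            rw [hc, Real.div_rpow hpi.le hN0.le, ← e2]
            linear_combination (N * |M| * ω (Real.pi / N) / N ^ (1 - β) / (1 - β)) * e1
          rw [e3]
          have h5 := hΩm n le_rfl
          rw [hb1, mul_one] at h5
          have : 0 < 1 - β := by linarith
          gcongr
  have hpiece : ∀ m ∈ Finset.Icc 1 n,
      ∫⁻ t in Set.Ioc (Real.pi / ((m : ℝ) + 1)) (Real.pi / (m : ℝ)), ENNReal.ofReal (W t) ≤
        ENNReal.ofReal (4 * Real.pi * C₀ * |M| * Ω * ((m : ℝ) + 1) ^ (γ - 1)) := by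
    intro m hm
    obtain ⟨hm1, hmn⟩ := Finset.mem_Icc.1 hm
    have hmR : (1 : ℝ) ≤ m := by exact_mod_cast hm1
    set L : ℝ := (m : ℝ) + 1 with hL
    have hL0 : 0 < L := by positivity
    set B := ∑ k ∈ Finset.range (m + 1), b n k with hB
    have hB0 : 0 ≤ B := Finset.sum_nonneg fun k hk =>
      hb0 n k (by have := Finset.mem_range.1 hk; omega)
    have hωL : 0 ≤ ω (Real.pi / L) := hω0 m
    set c : ℝ := C₀ * B * L * (|M| * (2 * ω (Real.pi / L)) * L ^ β) with hc
    have hc0 : 0 ≤ c := by positivity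
    have hbound : ∀ t ∈ Set.Ioc (Real.pi / L) (Real.pi / (m : ℝ)), W t ≤ c := by
      intro t ht
      have ht0 : 0 < t := lt_trans (by positivity) ht.1
      have htpi : t ≤ Real.pi := ht.2.trans (div_le_self hpi.le hmR)
      have htL : Real.pi / t ≤ L := by
        rw [div_le_iff₀ ht0, mul_comm, ← div_le_iff₀ hL0]; exact ht.1.le
      -- Since `m + 1 ≤ 2m`, the whole interval lies below `2π/(m+1)`, so doubling applies.
      have hω1 : ω t ≤ 2 * ω (Real.pi / L) := by
        refine le_trans ?_ (hω.two_mul_le (harg m).1 (harg m).2)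
        have h2 : t ≤ 2 * (Real.pi / L) := by
          refine ht.2.trans ?_
          rw [div_le_iff₀ (by linarith), mul_div_assoc', div_mul_eq_mul_div, le_div_iff₀ hL0]
          nlinarith
        exact hω.monotoneOn ⟨ht0.le, by linarith⟩
          ⟨by positivity, by have := (harg m).2; simp only [← hL] at this; linarith⟩ h2
      have hK : |meanKernel a n t| ≤ C₀ * B * L := by
        have h1 := hker n m hm1 hmn t ht.1.le htpi
        rw [← two_sin_half_mul_meanKernel, abs_mul] at h1
        have h2 : 1 / L ≤ |2 * Real.sin (t / 2)| := by
          have h3 := div_pi_le_sin_half ht0.le htpi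
          have h4 : 1 / L ≤ t / Real.pi := by
            rw [div_le_div_iff₀ hL0 hpi]
            rw [div_le_iff₀ ht0] at htL
            linarith
          have h5 : 0 < t / Real.pi := by positivity
          rw [abs_of_pos (by linarith)]
          linarith
        have h3 : 1 / L * |meanKernel a n t| ≤ C₀ * B :=
          (mul_le_mul_of_nonneg_right h2 (abs_nonneg _)).trans h1
        rwa [one_div_mul_eq_div, div_le_iff₀ hL0] at h3
      have hωt : 0 ≤ ω t := hω.nonneg ht0.le (by linarith)
      rw [hW, hc]
      simp only
      gcongr
    calc _ ≤ ∫⁻ t in Set.Ioc (Real.pi / L) (Real.pi / (m : ℝ)), ENNReal.ofReal c :=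
          setLIntegral_mono' measurableSet_Ioc fun t ht =>
            ENNReal.ofReal_le_ofReal (hbound t ht)
      _ = ENNReal.ofReal (c * (Real.pi / m - Real.pi / L)) := by
          rw [setLIntegral_const, Real.volume_Ioc, ← ENNReal.ofReal_mul hc0]
      _ ≤ _ := by
          refine ENNReal.ofReal_le_ofReal ?_
          have h1 : Real.pi / m - Real.pi / L ≤ 2 * Real.pi / L ^ 2 := by
            rw [div_sub_div _ _ (by positivity) hL0.ne', div_le_div_iff₀ (by positivity)
              (by positivity)]
            have e : Real.pi * L - m * Real.pi = Real.pi := by rw [hL]; ring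
            have h2 : L ≤ 2 * m := by rw [hL]; linarith
            rw [e]
            have := mul_le_mul_of_nonneg_left h2 (by positivity : 0 ≤ Real.pi * L)
            nlinarith
          have e2 : L ^ β * L / L ^ 2 = L ^ (β - 1) := by
            rw [Real.rpow_sub_one hL0.ne']; field_simp
          -- Passing from `β` to `γ > 0` makes the sum over `m` a power even when `β = 0`.
          have h3 : L ^ (β - 1) ≤ L ^ (γ - 1) :=
            Real.rpow_le_rpow_of_exponent_le (by rw [hL]; linarith) (by linarith)
          have h4 := hΩm m hmn
          calc _ ≤ c * (2 * Real.pi / L ^ 2) := by gcongr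
            _ = 4 * Real.pi * C₀ * |M| * (ω (Real.pi / L) * B) * (L ^ β * L / L ^ 2) := by
              rw [hc]; ring
            _ ≤ _ := by rw [e2]; gcongr
  refine (add_le_add hfirst (Finset.sum_le_sum hpiece)).trans ?_
  rw [← ENNReal.ofReal_sum_of_nonneg (fun m _ => by positivity), ← Finset.mul_sum,
    ← ENNReal.ofReal_add (by have : 0 < 1 - β := by linarith
                             positivity) (by positivity)]
  refine ENNReal.ofReal_le_ofReal ?_
  have hs : ∑ m ∈ Finset.Icc 1 n, ((m : ℝ) + 1) ^ (γ - 1) ≤ 1 / γ * ((n : ℝ) + 1) ^ γ :=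
    (Finset.sum_le_sum_of_subset_of_nonneg
      (fun m hm => Finset.mem_range.2 (by have := Finset.mem_Icc.1 hm; omega))
      fun m _ _ => by positivity).trans (sum_range_rpow_sub_one_le hγ0 hγ1 n)
  have := mul_le_mul_of_nonneg_left hs (by positivity : 0 ≤ 4 * Real.pi * C₀ * |M| * Ω)
  linarith

/-! ### Kernel bounds for the two classes of matrices -/

lemma abs_sum_Ico_sin_le_add_one {p q m : ℕ} (hpq : p ≤ q) {t : ℝ}
    (h0 : Real.pi / ((m : ℝ) + 1) ≤ t) (h1 : t ≤ Real.pi) :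
    |∑ k ∈ Finset.Ico p q, Real.sin ((k + 1 / 2) * t)| ≤ m + 1 := by
  have hpi := Real.pi_pos
  have hm : (0 : ℝ) < (m : ℝ) + 1 := by positivity
  have ht : 0 < t := lt_of_lt_of_le (by positivity) h0
  have hs := div_pi_le_sin_half ht.le h1
  have h2 : 1 / ((m : ℝ) + 1) ≤ Real.sin (t / 2) := by
    refine le_trans ?_ hs
    rw [div_le_iff₀ hm] at h0
    rw [div_le_div_iff₀ hm hpi]; linarith
  have h3 : 0 < Real.sin (t / 2) := lt_of_lt_of_le (by positivity) h2
  refine (abs_sum_Ico_sin_le hpq h3).trans ?_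
  rw [div_le_iff₀ h3]
  rw [div_le_iff₀ hm] at h2
  linarith

/-- The mean over `m/2 ≤ k ≤ m` is enlarged to all `k ≤ m`, the weaker form of the condition that
the Abel summation estimate uses. -/
lemma RowsMRBVS.exists_abs_sum_le {a : ℕ → ℕ → ℝ} (ha : IsMeanMatrix a) (h : RowsMRBVS a) :
    ∃ C : ℝ, 0 ≤ C ∧ ∀ n m : ℕ, 1 ≤ m → m ≤ n →
      ∀ t, Real.pi / ((m : ℝ) + 1) ≤ t → t ≤ Real.pi →
      |∑ k ∈ Finset.range (n + 1), a n k * Real.sin ((k + 1 / 2) * t)| ≤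
        C * ∑ k ∈ Finset.range (m + 1), a n k := by
  obtain ⟨K, hK⟩ := h
  refine ⟨3 + 4 * |K|, by positivity, fun n m hm hmn t h0 h1 => ?_⟩
  refine abs_sum_range_mul_le (u := fun k : ℕ => Real.sin ((k + 1 / 2) * t)) (abs_nonneg K)
    (fun k hk => ha.nonneg n k hk) (fun r hr hrn => ?_)
    hm hmn (fun k _ => Real.abs_sin_le_one _) (fun q hq _ => abs_sum_Ico_sin_le_add_one hq h0 h1)
  have hnn : ∀ k ∈ Finset.range (r + 1), 0 ≤ a n k := fun k hk =>
    ha.nonneg n k (by have := Finset.mem_range.1 hk; omega)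
  refine (hK n r hr hrn).trans ?_
  refine mul_le_mul ?_ (Finset.sum_le_sum_of_subset_of_nonneg (Finset.filter_subset _ _)
    fun k hk _ => hnn k hk) (Finset.sum_nonneg fun k hk => hnn k (Finset.mem_filter.1 hk).1)
    (by positivity)
  gcongr
  exact le_abs_self K

/-- Reversing the row turns head variation into rest variation, and a block of sines into another
block of sines, so the same Abel summation estimate applies. -/
lemma RowsMHBVS.exists_abs_sum_le {a : ℕ → ℕ → ℝ} (ha : IsMeanMatrix a) (h : RowsMHBVS a) :
    ∃ C : ℝ, 0 ≤ C ∧ ∀ n m : ℕ, 1 ≤ m → m ≤ n →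
      ∀ t, Real.pi / ((m : ℝ) + 1) ≤ t → t ≤ Real.pi →
      |∑ k ∈ Finset.range (n + 1), a n k * Real.sin ((k + 1 / 2) * t)| ≤
        C * ∑ k ∈ Finset.range (m + 1), a n (n - k) := by
  obtain ⟨K, hK⟩ := h
  refine ⟨3 + 4 * |K|, by positivity, fun n m hm hmn t h0 h1 => ?_⟩
  have key := abs_sum_range_mul_le (b := fun k => a n (n - k))
    (u := fun k : ℕ => Real.sin (((n - k : ℕ) + 1 / 2) * t)) (abs_nonneg K)
    (fun k _ => ha.nonneg n (n - k) (Nat.sub_le _ _)) (fun r hr hrn => ?_)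
    hm hmn (fun k _ => Real.abs_sin_le_one _) (fun q hq hqn => ?_)
  · rw [← Finset.sum_range_reflect]
    simpa only [Nat.add_sub_cancel] using key
  · have e1 : ∑ k ∈ Finset.Ico r n, |a n (n - k) - a n (n - (k + 1))| =
        ∑ k ∈ Finset.range (n - r), |a n k - a n (k + 1)| := by
      have := Finset.sum_Ico_reflect (fun k => |a n k - a n (k + 1)|) r
        (m := n) (n := n - 1) (by omega)
      rw [show n - 1 + 1 - n = 0 by omega, show n - 1 + 1 - r = n - r by omega,
        ← Finset.range_eq_Ico] at this
      rw [← this]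
      refine Finset.sum_congr rfl fun k hk => ?_
      have hk' := Finset.mem_Ico.1 hk
      rw [abs_sub_comm, show n - (k + 1) = n - 1 - k by omega, show n - 1 - k + 1 = n - k by omega]
    have e2 : ∑ k ∈ Finset.range (r + 1), a n (n - k) = ∑ k ∈ Finset.Icc (n - r) n, a n k := by
      have := Finset.sum_Ico_reflect (a n) 0 (m := r + 1) (n := n) (by omega)
      rw [← Finset.range_eq_Ico] at this
      rw [this]
      refine Finset.sum_congr ?_ fun _ _ => rfl
      ext k; simp only [Finset.mem_Ico, Finset.mem_Icc]; omega
    rw [e1, e2]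
    refine (hK n r hr hrn).trans ?_
    have : 0 ≤ ∑ k ∈ Finset.Icc (n - r) n, a n k :=
      Finset.sum_nonneg fun k hk => ha.nonneg n k (Finset.mem_Icc.1 hk).2
    gcongr
    exact le_abs_self K
  -- The restriction `q ≤ n + 1` keeps `n - k` a true subtraction, so the reflected block is again
  -- an interval of indices.
  · rw [Finset.sum_Ico_reflect (fun k : ℕ => Real.sin (((k : ℝ) + 1 / 2) * t)) m hqn]
    exact abs_sum_Ico_sin_le_add_one (by omega) h0 h1

end FourierMatrixMeans

end

/-! ### The two classes, with exponent `β` or `1 / p` -/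

open FourierMatrixMeans in
theorem theorem3 (p β : ℝ) (hp : 1 < p) (hβ0 : 0 ≤ β) (hβ1 : β < 1 - 1 / p)
    (ω : ℝ → ℝ) (hω : IsModulusType ω)
    (f : ℝ → ℝ) (hf : f ∈ classLpOmega p β ω)
    (a : ℕ → ℕ → ℝ) (ha : IsMeanMatrix a) :
    (RowsMRBVS a →
      (0 < β → ∃ C : ℝ, ∀ n : ℕ,
        normLp p (fun x => matrixMean a n f x - f x) ≤
          ENNReal.ofReal (C * (((n : ℝ) + 1) ^ β *
            ∑ k ∈ Finset.range (n + 1), a n k * ω (Real.pi / ((k : ℝ) + 1))))) ∧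
      (β = 0 → ∃ C : ℝ, ∀ n : ℕ,
        normLp p (fun x => matrixMean a n f x - f x) ≤
          ENNReal.ofReal (C * (((n : ℝ) + 1) ^ (1 / p) *
            ∑ k ∈ Finset.range (n + 1), a n k * ω (Real.pi / ((k : ℝ) + 1)))))) ∧
    (RowsMHBVS a →
      (0 < β → ∃ C : ℝ, ∀ n : ℕ,
        normLp p (fun x => matrixMean a n f x - f x) ≤
          ENNReal.ofReal (C * (((n : ℝ) + 1) ^ β *
            ∑ k ∈ Finset.range (n + 1), a n (n - k) * ω (Real.pi / ((k : ℝ) + 1))))) ∧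
      (β = 0 → ∃ C : ℝ, ∀ n : ℕ,
        normLp p (fun x => matrixMean a n f x - f x) ≤
          ENNReal.ofReal (C * (((n : ℝ) + 1) ^ (1 / p) *
            ∑ k ∈ Finset.range (n + 1), a n (n - k) * ω (Real.pi / ((k : ℝ) + 1)))))) := by
  have hp0 : 0 < 1 / p := by positivity
  have hp1 : 1 / p ≤ 1 := by linarith
  have hβ : β < 1 := by linarith
  have hrev : ∀ n, ∑ k ∈ Finset.range (n + 1), a n (n - k) = 1 := fun n => by
    rw [← ha.sum_eq_one n, ← Finset.sum_range_reflect (a n)]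
    simp only [Nat.add_sub_cancel]
  refine ⟨fun h => ?_, fun h => ?_⟩
  · obtain ⟨C₀, hC₀, hker⟩ := h.exists_abs_sum_le ha
    exact ⟨fun hpos => exists_normLp_matrixMean_sub_le hp hβ0 hβ hpos hβ.le le_rfl hC₀ hω hf ha
        ha.nonneg ha.sum_eq_one hker,
      -- For `β = 0` the choice `γ = 1 / p` supplies the positive exponent needed to absorb the
      -- harmonic sum.
      fun hzero => exists_normLp_matrixMean_sub_le hp hβ0 hβ hp0 hp1 (hzero ▸ hp0.le) hC₀ hω hf ha
        ha.nonneg ha.sum_eq_one hker⟩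
  · obtain ⟨C₀, hC₀, hker⟩ := h.exists_abs_sum_le ha
    have hnn : ∀ n k, k ≤ n → 0 ≤ a n (n - k) := fun n k _ => ha.nonneg n _ (Nat.sub_le _ _)
    exact ⟨fun hpos => exists_normLp_matrixMean_sub_le (b := fun n k => a n (n - k))
        hp hβ0 hβ hpos hβ.le le_rfl hC₀ hω hf ha hnn hrev hker,
      fun hzero => exists_normLp_matrixMean_sub_le (b := fun n k => a n (n - k))
        hp hβ0 hβ hp0 hp1 (hzero ▸ hp0.le) hC₀ hω hf ha hnn hrev hker⟩
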